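/- **Theorem.** All graphs are finite, undirected and without loops. A graph $H$ is a *core* if the smallest induced subgraph of $H$ to which $H$ admits a homomorphism is $H$ itself. An $m$-ary *polymorphism* of $H$ ($m\ge 1$) is a map $f\colon V_H^m\to V_H$ such that $(f(x_1,\dots,x_m),f(y_1,\dots,y_m))\in E_H$ whenever $(x_i,y_i)\in E_H$ for all $i$; it is *idempotent* if $f(v,\dots,v)=v$ for every $v\in V_H$. The graph $H$ is *projective* if every idempotent polymorphism of $H$ (of any arity $m\ge 1$) is a projection $(x_1,\dots,x_m)\mapsto x_i$. The *cross product* $H_1\times H_2$ has vertex set $V_{H_1}\times V_{H_2}$, with $(u_1,v_1)$ and $(u_2,v_2)$ adjacent if and only if $(u_1,u_2)\in E_{H_1}$ and $(v_1,v_2)\in E_{H_2}$; $H$ is *indecomposable* if it is not isomorphic to a cross product of two graphs with at least two vertices each. Let $H$ be a core with $3\le |V_H|\le 7$. Then $H$ is projective. Moreover, if $H$ is connected, then $H$ is projective if and only if it is indecomposable; that is, the Okrasa–Rzążewski conjecture holds for all graphs on at most $7$ vertices. -/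

import Mathlib

namespace SimpleGraph

/-- `H` is a core: the smallest induced subgraph of `H` to which `H` admits a homomorphism is `H`
itself, i.e. there is no homomorphism from `H` to an induced subgraph on fewer vertices. -/
def IsCore {V : Type*} (H : SimpleGraph V) : Prop :=
  ∀ S : Set V, Nonempty (H →g H.induce S) → S = Set.univ

/-- `f : V ^ m → V` is an (`m`-ary, total) polymorphism of the edge relation of `H`. -/
def IsPolymorphism {V : Type*} (H : SimpleGraph V) {m : ℕ} (f : (Fin m → V) → V) : Prop :=
  ∀ x y : Fin m → V, (∀ i, H.Adj (x i) (y i)) → H.Adj (f x) (f y)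

/-- `H` is projective: every idempotent polymorphism of `H`, of any arity `m ≥ 1`,
is a projection on one of its coordinates. -/
def IsProjective {V : Type*} (H : SimpleGraph V) : Prop :=
  ∀ (m : ℕ), 1 ≤ m → ∀ f : (Fin m → V) → V, H.IsPolymorphism f →
    (∀ v : V, f (fun _ => v) = v) → ∃ i : Fin m, ∀ x : Fin m → V, f x = x i

/-- The cross product (categorical product) `G × H` of two graphs. -/
def crossProd {A B : Type*} (G : SimpleGraph A) (H : SimpleGraph B) : SimpleGraph (A × B) where
  Adj p q := G.Adj p.1 q.1 ∧ H.Adj p.2 q.2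
  symm := ⟨fun _ _ h => ⟨h.1.symm, h.2.symm⟩⟩
  loopless := ⟨fun _ h => G.irrefl h.1⟩

/-- `H` is decomposable: it is isomorphic to the cross product of two non-trivial graphs,
i.e. of two graphs with at least two vertices each. -/
def IsDecomposable.{u} {V : Type u} (H : SimpleGraph V) : Prop :=
  ∃ (A B : Type u) (G₁ : SimpleGraph A) (G₂ : SimpleGraph B),
    Nontrivial A ∧ Nontrivial B ∧ Nonempty (H ≃g G₁.crossProd G₂)

/-- `H` is indecomposable: it is not decomposable. -/
def IsIndecomposable.{u} {V : Type u} (H : SimpleGraph V) : Prop :=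
  ¬ H.IsDecomposable

end SimpleGraph

/-!
A core on at most seven vertices is projective, and therefore indecomposable: on a cross product,
`((a, b), (c, d)) ↦ (a, d)` is an idempotent polymorphism which is not a projection. The work is
to prove projectivity.

*From disequality to projections.* Idempotent polymorphisms preserve every relation with a
primitive positive definition from the edge relation and constants. If disequality on a set `S` of
at least three vertices has such a definition, then an idempotent polymorphism `f` is a projection
on tuples from `S`, because the sets of coordinates that decide the value of `f` form a principal
ultrafilter (`Preserves.exists_forall_eq_apply`). It is a projection on all tuples if, in addition,
any two vertices `v ≠ w` are separated by a definable relation `r` that relates every vertex to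
some element of `S`: some `s ∈ S` is related to `v` but not to `w`
(`isProjective_of_gadget`). For the cycles of length five and seven, disequality is the relation of
being joined by a walk of length three and five; the other seven-vertex graphs need constants.

*Universal vertices.* If `u` is adjacent to all other vertices of a core `H`, then `H - u` is a
core, and if `H - u` is projective then so is `H`
(`isProjective_of_induce_compl_singleton`). So only the triangle and the cores without universal
vertex have to be treated.

*Classification.* These are the triangle, the pentagon and eight graphs on seven vertices (the
`Template`s). The classification is a verified search. In a core no neighbourhood contains
another one, and this condition prunes partial graphs; at a leaf, the search exhibits an
isomorphism to a template or an endomorphism that is not injective. Isomorphic copies are avoided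
by a normal form that fixes the neighbourhoods of two vertices: one of maximal degree, and a
neighbour of it whose degree is maximal (`Search.exists_isNormal`).
The soundness of the search is `Search.IsNormal.exists_iso`.
-/

namespace SimpleGraph

/-! ### Operations preserving inequality -/

section Inequality

variable {V : Type*} {m : ℕ} {f : (Fin m → V) → V} {S : Set V}

/-- `f` preserves the binary relation `R`: it is a polymorphism of `R`. -/
def Preserves (f : (Fin m → V) → V) (R : V → V → Prop) : Prop :=
  ∀ x y : Fin m → V, (∀ i, R (x i) (y i)) → R (f x) (f y)

/-- The disequality relation on the set `S`. -/
def NeOn (S : Set V) (x y : V) : Prop := x ∈ S ∧ y ∈ S ∧ x ≠ y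

/-- The tuple with entry `a` on `I` and `b` elsewhere. -/
def mix (I : Finset (Fin m)) (a b : V) : Fin m → V := fun i => if i ∈ I then a else b

/-- A set `I` of coordinates is decisive (for `f` on `S`) if `f` takes the value `a` on some
two-valued tuple that is `a` exactly on `I`. -/
def Decisive (f : (Fin m → V) → V) (S : Set V) (I : Finset (Fin m)) : Prop :=
  ∃ a ∈ S, ∃ b ∈ S, a ≠ b ∧ f (mix I a b) = a

theorem Preserves.exists_eq_apply (hf : Preserves f (NeOn S)) (hid : ∀ v, f (fun _ => v) = v)
    (h3 : ∀ a b, ∃ c ∈ S, c ≠ a ∧ c ≠ b) {x : Fin m → V} (hx : ∀ i, x i ∈ S) :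
    f x ∈ S ∧ ∃ i, f x = x i := by
  have hS : f x ∈ S := by
    choose c hc hca _ using fun i => h3 (x i) (x i)
    exact (hf x c fun i => ⟨hx i, hc i, (hca i).symm⟩).1
  refine ⟨hS, ?_⟩
  by_contra! hne
  exact (hf x (fun _ => f x) fun i => ⟨hx i, hS, (hne i).symm⟩).2.2 (hid _).symm

theorem mix_mem {I : Finset (Fin m)} {a b : V} (ha : a ∈ S) (hb : b ∈ S) (i : Fin m) :
    mix I a b i ∈ S := by
  unfold mix; split_ifs <;> assumption

theorem Preserves.mix_eq_or (hf : Preserves f (NeOn S)) (hid : ∀ v, f (fun _ => v) = v)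
    (h3 : ∀ a b, ∃ c ∈ S, c ≠ a ∧ c ≠ b) (I : Finset (Fin m)) {a b : V} (ha : a ∈ S)
    (hb : b ∈ S) : f (mix I a b) = a ∨ f (mix I a b) = b := by
  obtain ⟨i, hi⟩ := (hf.exists_eq_apply hid h3 (mix_mem (I := I) ha hb)).2
  rw [hi]; unfold mix; split_ifs <;> simp

/-- Decisiveness does not depend on the pair of values. -/
theorem Decisive.apply_mix (hf : Preserves f (NeOn S)) (hid : ∀ v, f (fun _ => v) = v)
    (h3 : ∀ a b, ∃ c ∈ S, c ≠ a ∧ c ≠ b) {I : Finset (Fin m)} (hI : Decisive f S I) {a b : V}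
    (ha : a ∈ S) (hb : b ∈ S) (hab : a ≠ b) : f (mix I a b) = a := by
  have step : ∀ a ∈ S, ∀ b ∈ S, ∀ c ∈ S, a ≠ b → b ≠ c → f (mix I a b) = b →
      f (mix I b c) = c := by
    intro a ha b hb c hc hab hbc h
    refine (hf.mix_eq_or hid h3 I hb hc).resolve_left fun h' => ?_
    refine (hf (mix I a b) (mix I b c) fun i => ⟨mix_mem ha hb i, mix_mem hb hc i, ?_⟩).2.2
      (h.trans h'.symm)
    unfold mix; split_ifs <;> assumption
  obtain ⟨c, hc, d, hd, hcd, hI⟩ := hI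
  refine (hf.mix_eq_or hid h3 I ha hb).resolve_right fun h => hcd ?_
  rw [← hI]
  by_cases hcb : c = b
  · subst hcb
    exact step a ha c hb d hd hab hcd h
  · exact step b hb c hc d hd (Ne.symm hcb) hcd (step a ha b hb c hc hab (Ne.symm hcb) h)

theorem Decisive.not_of_disjoint (hf : Preserves f (NeOn S)) (hid : ∀ v, f (fun _ => v) = v)
    (h3 : ∀ a b, ∃ c ∈ S, c ≠ a ∧ c ≠ b) {I J : Finset (Fin m)} (hIJ : Disjoint I J)
    (hI : Decisive f S I) : ¬ Decisive f S J := by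
  intro hJ
  obtain ⟨a, ha, b, hb, hab, hIa⟩ := hI
  obtain ⟨c, hc, hca, hcb⟩ := h3 a b
  refine (hf (mix I a b) (mix J a c) fun i => ⟨mix_mem ha hb i, mix_mem ha hc i, ?_⟩).2.2 ?_
  · have : i ∈ I → i ∉ J := fun h => Finset.disjoint_left.1 hIJ h
    unfold mix; split_ifs <;> grind
  · rw [hIa, hJ.apply_mix hf hid h3 ha hc hca.symm]

theorem Decisive.of_partition (hf : Preserves f (NeOn S)) (hid : ∀ v, f (fun _ => v) = v)
    (h3 : ∀ a b, ∃ c ∈ S, c ≠ a ∧ c ≠ b) {a : V} (ha : a ∈ S) {I J : Finset (Fin m)}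
    (hIJ : Disjoint I J) : Decisive f S I ∨ Decisive f S J ∨ Decisive f S (I ∪ J)ᶜ := by
  obtain ⟨b, hb, hba, -⟩ := h3 a a
  obtain ⟨c, hc, hca, hcb⟩ := h3 a b
  have hd : ∀ i, i ∈ I → i ∉ J := fun i h => Finset.disjoint_left.1 hIJ h
  set x : Fin m → V := fun i => if i ∈ I then a else if i ∈ J then b else c with hx
  have hxS : ∀ i, x i ∈ S := fun i => by simp only [hx]; split_ifs <;> assumption
  -- If `f x` is one of the three values `u`, then `f` must take the other value `w` on the tuple
  -- that is `w` where `x` is `u`, and `u` elsewhere.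
  have key : ∀ K : Finset (Fin m), ∀ u ∈ S, ∀ w ∈ S, w ≠ u → (∀ i, x i = u ↔ i ∈ K) → f x = u →
      Decisive f S K := by
    intro K u hu w hw hwu hK hfx
    refine ⟨w, hw, u, hu, hwu, (hf.mix_eq_or hid h3 K hw hu).resolve_right fun h => ?_⟩
    refine (hf x (mix K w u) fun i => ⟨hxS i, mix_mem hw hu i, ?_⟩).2.2 (hfx.trans h.symm)
    have := hK i
    unfold mix; split_ifs <;> grind
  obtain ⟨i, hi⟩ := (hf.exists_eq_apply hid h3 hxS).2
  have hval : f x = a ∨ f x = b ∨ f x = c := by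
    rw [hi]; simp only [hx]; split_ifs <;> simp
  rcases hval with h | h | h
  · exact Or.inl (key I a ha b hb hba (fun i => by simp only [hx]; grind) h)
  · exact Or.inr (Or.inl (key J b hb a ha hba.symm (fun i => by simp only [hx]; grind) h))
  · refine Or.inr (Or.inr (key _ c hc a ha hca.symm (fun i => ?_) h))
    simp only [hx, Finset.mem_compl, Finset.mem_union]; grind

/-- An idempotent operation that preserves disequality on a set with at least three elements is
a projection there: the decisive sets of coordinates form a principal ultrafilter. -/
theorem Preserves.exists_forall_eq_apply (hf : Preserves f (NeOn S))
    (hid : ∀ v, f (fun _ => v) = v) (hS : S.Nonempty) (h3 : ∀ a b, ∃ c ∈ S, c ≠ a ∧ c ≠ b) :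
    ∃ i, ∀ x : Fin m → V, (∀ j, x j ∈ S) → f x = x i := by
  obtain ⟨a, ha⟩ := hS
  obtain ⟨b, hb, hba, -⟩ := h3 a a
  have huniv : Decisive f S Finset.univ :=
    ⟨a, ha, b, hb, hba.symm, (congrArg f (funext fun i => by simp [mix])).trans (hid a)⟩
  have hempty : ¬ Decisive f S ∅ :=
    Decisive.not_of_disjoint hf hid h3 (Finset.disjoint_empty_right _) huniv
  obtain ⟨i, hi⟩ : ∃ i, Decisive f S {i} := by
    classical
    obtain ⟨I, hI, hmin⟩ := Finset.exists_min_image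
      (Finset.univ.filter fun I : Finset (Fin m) => Decisive f S I) Finset.card
      ⟨_, Finset.mem_filter.2 ⟨Finset.mem_univ _, huniv⟩⟩
    simp only [Finset.mem_filter, Finset.mem_univ, true_and] at hI hmin
    obtain ⟨i, hiI⟩ : I.Nonempty := by
      rw [Finset.nonempty_iff_ne_empty]; rintro rfl; exact hempty hI
    have hu : {i} ∪ I.erase i = I := by ext j; simp; grind
    rcases Decisive.of_partition (I := {i}) (J := I.erase i) hf hid h3 ha (by simp) with h | h | h
    · exact ⟨i, h⟩
    · exact absurd (hmin _ h) (not_le.2 (Finset.card_erase_lt_of_mem hiI))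
    · rw [hu] at h
      exact absurd h (hI.not_of_disjoint hf hid h3 disjoint_compl_right)
  refine ⟨i, fun x hx => ?_⟩
  by_contra hne
  have hfx := (hf.exists_eq_apply hid h3 hx).1
  classical
  set T : Finset (Fin m) := Finset.univ.filter fun j => x j ≠ f x with hT
  have hmem : ∀ j, j ∈ T ↔ x j ≠ f x := fun j => by simp [hT]
  have hTd : Decisive f S T := by
    rcases Decisive.of_partition (I := T) (J := ∅) hf hid h3 ha (by simp) with h | h | h
    · exact h
    · exact absurd h hempty
    · refine absurd h (hi.not_of_disjoint hf hid h3 ?_)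
      simp [hmem, Ne.symm hne]
  obtain ⟨c, hc, hcx, -⟩ := h3 (f x) (f x)
  refine (hf x (mix T (f x) c) fun j => ⟨hx j, mix_mem hfx hc j, ?_⟩).2.2
    (hTd.apply_mix hf hid h3 hfx hc hcx.symm).symm
  have := hmem j
  unfold mix; split_ifs <;> grind

end Inequality

/-! ### Relations definable from the edges and constants -/

/-- A primitive positive definition of a binary relation from the edge relation and constants:
`full` is the total relation, `const c` is `{(c, c)}`, `comp` is relational composition and
`inter` is intersection. -/
inductive Gadget (V : Type*)
  | adj : Gadget V
  | full : Gadget V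
  | const : V → Gadget V
  | comp : Gadget V → Gadget V → Gadget V
  | inter : Gadget V → Gadget V → Gadget V

/-- The relation that a gadget defines in the graph `H`. -/
def Gadget.Rel {V : Type*} (H : SimpleGraph V) : Gadget V → V → V → Prop
  | .adj, x, y => H.Adj x y
  | .full, _, _ => True
  | .const c, x, y => x = c ∧ y = c
  | .comp a b, x, y => ∃ z, a.Rel H x z ∧ b.Rel H z y
  | .inter a b, x, y => a.Rel H x y ∧ b.Rel H x y

theorem IsPolymorphism.preserves_rel {V : Type*} {H : SimpleGraph V} {m : ℕ}
    {f : (Fin m → V) → V} (hf : H.IsPolymorphism f) (hid : ∀ v, f (fun _ => v) = v)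
    (g : Gadget V) : Preserves f (g.Rel H) := by
  induction g with
  | adj => exact hf
  | full => exact fun _ _ _ => trivial
  | const c =>
    intro x y h
    rw [funext fun i => (h i).1, funext fun i => (h i).2]
    exact ⟨hid c, hid c⟩
  | comp a b iha ihb =>
    intro x y h
    choose z hz using h
    exact ⟨f z, iha x z fun i => (hz i).1, ihb z y fun i => (hz i).2⟩
  | inter a b iha ihb =>
    exact fun x y h => ⟨iha x y fun i => (h i).1, ihb x y fun i => (h i).2⟩

/-- A criterion for projectivity. If disequality on `S` is definable, then an idempotent
polymorphism `f` is a projection on tuples from `S`. Any tuple `x` is related, by each separating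
relation, to a tuple from `S` with a prescribed entry in the relevant coordinate `i`, so that the
value `f x` cannot be separated from `x i`. -/
theorem isProjective_of_gadget {V : Type*} {H : SimpleGraph V} {S : Set V} (hS : S.Nonempty)
    (h3 : ∀ a b, ∃ c ∈ S, c ≠ a ∧ c ≠ b) (g : Gadget V)
    (hg : ∀ x y, g.Rel H x y ↔ NeOn S x y)
    (hsep : ∀ v w, v ≠ w → ∃ r : Gadget V, (∀ u, ∃ s ∈ S, r.Rel H u s) ∧
      ∃ s ∈ S, r.Rel H v s ∧ ¬ r.Rel H w s) : H.IsProjective := by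
  intro m _ f hf hid
  have hne : Preserves f (NeOn S) := fun x y h =>
    (hg _ _).1 (hf.preserves_rel hid g x y fun i => (hg _ _).2 (h i))
  obtain ⟨i, hi⟩ := hne.exists_forall_eq_apply hid hS h3
  refine ⟨i, fun x => ?_⟩
  by_contra hx
  obtain ⟨r, htot, s, hs, hrs, hns⟩ := hsep (x i) (f x) (Ne.symm hx)
  choose t htS ht using htot
  apply hns
  have hy : f (Function.update (fun j => t (x j)) i s) = s := by
    rw [hi _ fun j => ?_, Function.update_self]
    by_cases hj : j = i
    · subst hj; simpa using hs
    · simpa [hj] using htS (x j)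
  rw [← hy]
  refine hf.preserves_rel hid r _ _ fun j => ?_
  by_cases hj : j = i
  · subst hj; simpa using hrs
  · simpa [hj] using ht (x j)

/-! ### Cores -/

section Core

variable {V W : Type*} {H : SimpleGraph V}

theorem isCore_iff_forall_surjective :
    H.IsCore ↔ ∀ φ : H →g H, Function.Surjective φ := by
  constructor
  · intro h φ
    rw [← Set.range_eq_univ]
    exact h _ ⟨⟨fun v => ⟨φ v, v, rfl⟩, fun hab => φ.map_adj hab⟩⟩
  · rintro h S ⟨φ⟩
    refine Set.eq_univ_of_forall fun v => ?_
    obtain ⟨w, rfl⟩ := h ((Embedding.induce S).toHom.comp φ) v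
    exact (φ w).2

/-- In a core no neighbourhood contains another: otherwise one vertex folds onto the other. -/
theorem IsCore.exists_adj_not_adj (h : H.IsCore) {u v : V} (huv : u ≠ v) :
    ∃ w, H.Adj u w ∧ ¬ H.Adj v w := by
  classical
  by_contra! hN
  let φ : H →g H := ⟨fun x => if x = u then v else x, fun {a b} hab => by
    by_cases ha : a = u <;> by_cases hb : b = u
    · subst ha hb; exact absurd hab (H.loopless.irrefl _)
    · subst ha; simpa [hb] using hN b hab
    · subst hb; simpa [ha] using (hN a hab.symm).symm
    · simpa [ha, hb] using hab⟩
  obtain ⟨w, hw⟩ := isCore_iff_forall_surjective.1 h φ u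
  change (if w = u then v else w) = u at hw
  split_ifs at hw with hwu
  · exact huv hw.symm
  · exact hwu hw

theorem IsCore.of_iso {H' : SimpleGraph W} (h : H.IsCore) (e : H ≃g H') : H'.IsCore := by
  rw [isCore_iff_forall_surjective] at h ⊢
  intro φ w
  obtain ⟨v, hv⟩ := h ((e.symm.toHom.comp φ).comp e.toHom) (e.symm w)
  exact ⟨e v, e.symm.injective hv⟩

theorem IsProjective.of_iso {H' : SimpleGraph W} (h : H'.IsProjective) (e : H ≃g H') :
    H.IsProjective := by
  intro m hm f hf hid
  obtain ⟨i, hi⟩ := h m hm (fun x => e (f fun j => e.symm (x j)))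
    (fun x y hxy => e.map_adj_iff.2 (hf _ _ fun j => e.symm.map_adj_iff.2 (hxy j)))
    (fun w => by simp [hid])
  exact ⟨i, fun x => e.injective (by simpa using hi fun j => e (x j))⟩

end Core

/-! ### Universal vertices -/

section Universal

variable {V : Type*} {H : SimpleGraph V} {u : V}

theorem IsCore.induce_compl_singleton (h : H.IsCore) (hu : ∀ v, v ≠ u → H.Adj u v) :
    (H.induce {u}ᶜ).IsCore := by
  classical
  rw [isCore_iff_forall_surjective] at h ⊢
  intro φ
  let ψ : H →g H := ⟨fun x => if hx : x = u then u else φ ⟨x, hx⟩, fun {a b} hab => by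
    by_cases ha : a = u <;> by_cases hb : b = u
    · subst ha hb; exact absurd hab (H.loopless.irrefl _)
    · subst ha; simpa [hb] using hu _ (φ ⟨b, hb⟩).2
    · subst hb; simpa [ha] using (hu _ (φ ⟨a, ha⟩).2).symm
    · simp only [ha, hb, dite_false]
      exact φ.map_adj (v := ⟨a, ha⟩) (w := ⟨b, hb⟩) hab⟩
  rintro ⟨w, hw⟩
  obtain ⟨x, hx⟩ := h ψ w
  change (if hx : x = u then u else (φ ⟨x, hx⟩ : V)) = w at hx
  split_ifs at hx with hxu
  · exact absurd hx.symm hw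
  · exact ⟨⟨x, hxu⟩, Subtype.ext hx⟩

/-- Adding a universal vertex to a nontrivial projective core gives a projective graph. -/
theorem isProjective_of_induce_compl_singleton (hu : ∀ v, v ≠ u → H.Adj u v)
    (hnt : Nontrivial ({u}ᶜ : Set V)) (hcore : (H.induce {u}ᶜ).IsCore)
    (hproj : (H.induce {u}ᶜ).IsProjective) : H.IsProjective := by
  intro m hm f hf hid
  have hmem : ∀ x : Fin m → V, (∀ j, x j ≠ u) → f x ≠ u := by
    intro x hx h
    have := hf (fun _ => u) x fun j => hu _ (hx j)
    rw [hid, h] at this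
    exact H.loopless.irrefl _ this
  obtain ⟨i, hi⟩ := hproj m hm
    (fun x => ⟨f fun j => x j, hmem _ fun j => (x j).2⟩)
    (fun x y hxy => hf _ _ hxy) (fun v => Subtype.ext (hid v))
  replace hi : ∀ x : Fin m → V, (∀ j, x j ≠ u) → f x = x i := fun x hx =>
    congrArg Subtype.val (hi fun j => ⟨x j, hx j⟩)
  have hnbr : ∀ v, ∃ w, w ≠ u ∧ H.Adj v w := by
    intro v
    by_cases hv : v = u
    · subst hv
      obtain ⟨w⟩ := hnt.to_nonempty
      exact ⟨w, w.2, hu _ w.2⟩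
    · obtain ⟨w, hw⟩ := exists_ne (⟨v, hv⟩ : ({u}ᶜ : Set V))
      obtain ⟨z, hz, -⟩ := hcore.exists_adj_not_adj hw.symm
      exact ⟨z, z.2, hz⟩
  choose t htu ht using hnbr
  -- Every neighbour `s ≠ u` of `x i` is adjacent to `f x`.
  have hadj : ∀ x : Fin m → V, ∀ s, s ≠ u → H.Adj (x i) s → H.Adj (f x) s := by
    intro x s hs hxs
    have hy : f (Function.update (fun j => t (x j)) i s) = s := by
      rw [hi _ fun j => ?_, Function.update_self]
      by_cases hj : j = i
      · subst hj; simpa using hs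
      · simpa [hj] using htu (x j)
    rw [← hy]
    refine hf _ _ fun j => ?_
    by_cases hj : j = i
    · subst hj; simpa using hxs
    · simpa [hj] using ht (x j)
  have hfu : ∀ x : Fin m → V, x i = u → f x = u := by
    intro x hx
    by_contra hne
    exact H.loopless.irrefl _ (hadj x (f x) hne (hx ▸ hu _ hne))
  refine ⟨i, fun x => ?_⟩
  by_cases hx : x i = u
  · rw [hfu x hx, hx]
  have hne : f x ≠ u := by
    intro h
    have := hf x (Function.update (fun j => t (x j)) i u) fun j => by
      by_cases hj : j = i
      · subst hj; simpa using (hu _ hx).symm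
      · simpa [hj] using ht (x j)
    rw [h, hfu _ (by simp)] at this
    exact H.loopless.irrefl _ this
  by_contra hxi
  obtain ⟨s, hs, hns⟩ := hcore.exists_adj_not_adj (u := ⟨x i, hx⟩) (v := ⟨f x, hne⟩)
    fun h => hxi (congrArg Subtype.val h).symm
  exact hns (hadj x s s.2 hs)

end Universal

/-! ### Evaluating gadgets on graphs with few vertices -/

/-- The number whose first `k` binary digits are given by `p`. -/
def bitsOf (p : ℕ → Bool) : ℕ → ℕ
  | 0 => 0
  | k + 1 => bitsOf p k ||| (bif p k then 2 ^ k else 0)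

theorem testBit_bitsOf (p : ℕ → Bool) (k i : ℕ) :
    (bitsOf p k).testBit i = (decide (i < k) && p i) := by
  induction k with
  | zero => simp [bitsOf]
  | succ k ih =>
    rw [bitsOf, Nat.testBit_or, ih]
    cases hp : p k
    · by_cases h : i = k
      · subst h; simp [hp]
      · have : i < k + 1 ↔ i < k := by omega
        simp [this]
    · by_cases h : i = k
      · subst h; simp [hp]
      · have : i < k + 1 ↔ i < k := by omega
        simp [this, Nat.testBit_two_pow_of_ne (Ne.symm h)]

/-- Whether the pair `(x, y)` belongs to the binary relation on `{0, …, 7}` that is encoded by the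
`64`-bit number `M`. -/
def bit (M x y : ℕ) : Bool := M.testBit (8 * x + y)

/-- The `64`-bit encoding of a binary relation on `{0, …, 7}`. -/
def encode (p : ℕ → ℕ → Bool) : ℕ := bitsOf (fun k => p (k / 8) (k % 8)) 64

theorem bit_encode (p : ℕ → ℕ → Bool) {x y : ℕ} (hx : x < 8) (hy : y < 8) :
    bit (encode p) x y = p x y := by
  have h1 : 8 * x + y < 64 := by omega
  have h2 : (8 * x + y) / 8 = x := by omega
  have h3 : (8 * x + y) % 8 = y := by omega
  simp [bit, encode, testBit_bitsOf, h1, h2, h3]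

/-- The encoding of the relation that a gadget defines, if `E` encodes the edge relation. -/
def Gadget.mask {n : ℕ} (E : ℕ) : Gadget (Fin n) → ℕ
  | .adj => E
  | .full => encode fun _ _ => true
  | .const c => encode fun x y => Nat.beq x c && Nat.beq y c
  | .comp a b => encode fun x y =>
      (List.range n).any fun z => bit (a.mask E) x z && bit (b.mask E) z y
  | .inter a b => a.mask E &&& b.mask E

theorem Gadget.bit_mask {n : ℕ} (hn : n ≤ 8) {H : SimpleGraph (Fin n)} {E : ℕ}
    (hE : ∀ x y : Fin n, bit E x y = true ↔ H.Adj x y) (g : Gadget (Fin n)) (x y : Fin n) :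
    bit (g.mask E) x y = true ↔ g.Rel H x y := by
  have hlt : ∀ z : Fin n, (z : ℕ) < 8 := fun z => z.2.trans_le hn
  induction g generalizing x y with
  | adj => exact hE x y
  | full => simp [Gadget.mask, Gadget.Rel, bit_encode _ (hlt x) (hlt y)]
  | const c =>
    simp only [Gadget.mask, Gadget.Rel, bit_encode _ (hlt x) (hlt y), Bool.and_eq_true,
      Nat.beq_eq, Fin.ext_iff]
  | comp a b iha ihb =>
    simp only [Gadget.mask, Gadget.Rel, bit_encode _ (hlt x) (hlt y), List.any_eq_true,
      List.mem_range, Bool.and_eq_true]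
    constructor
    · rintro ⟨z, hz, h⟩
      exact ⟨⟨z, hz⟩, (iha x ⟨z, hz⟩).1 h.1, (ihb ⟨z, hz⟩ y).1 h.2⟩
    · rintro ⟨z, h⟩
      exact ⟨z, z.2, (iha x z).2 h.1, (ihb z y).2 h.2⟩
  | inter a b iha ihb =>
    have ha := iha x y
    have hb := ihb x y
    simp only [bit] at ha hb
    simp [Gadget.mask, Gadget.Rel, bit, Nat.testBit_and, ha, hb]

/-- A graph on `{0, …, n - 1}` together with the gadgets that prove it projective by
`isProjective_of_gadget`. The neighbourhood of the vertex `u` consists of the binary digits of the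
`u`-th row, and the set on which disequality is definable consists of those of `carrier`. -/
structure Template (n : ℕ) where
  rows : List ℕ
  carrier : ℕ
  ne : Gadget (Fin n)
  seps : List (Gadget (Fin n))

namespace Template

variable {n : ℕ} (t : Template n)

/-- The graph of a template. -/
def graph : SimpleGraph (Fin n) :=
  SimpleGraph.fromRel fun u v => (t.rows.getD u 0).testBit v

instance : DecidableRel t.graph.Adj := fun u v =>
  decidable_of_iff (u ≠ v ∧
    ((t.rows.getD u 0).testBit v = true ∨ (t.rows.getD v 0).testBit u = true)) Iff.rfl

/-- The encoding of the edge relation of a template. -/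
def edges : ℕ := encode fun u v => (t.rows.getD u 0).testBit v

/-- The computations that show the graph of a template to be projective. -/
def Valid : Prop :=
  (∀ u v : Fin n, bit t.edges u v = true ↔ t.graph.Adj u v) ∧
  (∀ u v : Fin n, ∃ w : Fin n, t.carrier.testBit w = true ∧ w ≠ u ∧ w ≠ v) ∧
  (∀ u v : Fin n, bit (t.ne.mask t.edges) u v = true ↔
    t.carrier.testBit u = true ∧ t.carrier.testBit v = true ∧ u ≠ v) ∧
  (∀ v w : Fin n, v ≠ w → ∃ r ∈ t.seps,
    (∀ u : Fin n, ∃ s : Fin n, t.carrier.testBit s = true ∧ bit (r.mask t.edges) u s = true) ∧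
    ∃ s : Fin n, t.carrier.testBit s = true ∧ bit (r.mask t.edges) v s = true ∧
      ¬ bit (r.mask t.edges) w s = true)

instance : Decidable t.Valid := by unfold Valid; infer_instance

variable {t}

theorem Valid.isProjective (h : t.Valid) (h0 : 0 < n) (hn : n ≤ 8) : t.graph.IsProjective := by
  obtain ⟨hE, h3, hne, hsep⟩ := h
  have hg := fun g => Gadget.bit_mask hn hE g
  obtain ⟨w, hw, -⟩ := h3 ⟨0, h0⟩ ⟨0, h0⟩
  refine isProjective_of_gadget (S := {v : Fin n | t.carrier.testBit v = true}) ⟨w, hw⟩ h3 t.ne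
    (fun x y => (hg _ x y).symm.trans (hne x y)) fun v w hvw => ?_
  obtain ⟨r, -, h1, h2⟩ := hsep v w hvw
  simp only [hg] at h1 h2
  exact ⟨r, h1, h2⟩

end Template

/-! ### Templates for the cores without universal vertex -/

namespace Gadget

variable {n : ℕ}

/-- A set `X` of vertices is represented by the relation `X × V`, here for `X = {c}`. -/
def point (c : Fin n) : Gadget (Fin n) := comp (const c) full

/-- The set of all vertices with a neighbour in `X`. -/
def nbr (X : Gadget (Fin n)) : Gadget (Fin n) := comp adj X

/-- The pairs joined by a walk of length two whose middle vertex lies in `X`. -/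
def through (X : Gadget (Fin n)) : Gadget (Fin n) := comp adj (inter adj X)

/-- The pairs of neighbours of `c`. -/
def square (c : Fin n) : Gadget (Fin n) := comp adj (comp (const c) adj)

/-- The pairs joined by a walk of length three whose middle edge lies in `R`. -/
def around (R : Gadget (Fin n)) : Gadget (Fin n) := comp adj (comp (inter adj R) adj)

/-- The separating gadgets that are used for all templates on seven vertices. -/
def separators : List (Gadget (Fin 7)) :=
  adj :: comp adj adj :: (List.finRange 7).map fun c => through (nbr (point c))

end Gadget

open Gadget

/-- The triangle. -/
def triangle : Template 3 where
  rows := [6, 5, 3]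
  carrier := 7
  ne := adj
  seps := [adj]

/-- The cycle of length five. Walks of length three join all pairs of distinct vertices. -/
def pentagon : Template 5 where
  rows := [18, 5, 10, 20, 9]
  carrier := 31
  ne := comp adj (comp adj adj)
  seps := [comp adj (comp adj adj)]

/-- The cycle of length seven. Walks of length five join all pairs of distinct vertices. -/
def heptagon : Template 7 where
  rows := [66, 5, 10, 20, 40, 80, 33]
  carrier := 127
  ne := comp (comp adj adj) (comp adj (comp adj adj))
  seps := [comp (comp adj adj) (comp adj (comp adj adj))]

/-- The fan over the path `1, 4, 3, 2` with centre `0`, and the edge `{5, 6}` joined to both ends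
of the path. -/
def fanDiamond : Template 7 where
  rows := [30, 113, 105, 21, 11, 70, 38]
  carrier := 70
  ne := inter (square 5) (around (square 0))
  seps := separators

/-- The square of the path `3, 4, 0, 2, 1, 6, 5`, with the two ends of the path joined. -/
def closedStrip : Template 7 where
  rows := [30, 101, 83, 49, 13, 74, 38]
  carrier := 13
  ne := inter (square 4) (around (square 1))
  seps := separators

/-- The graph `fanDiamond` with the additional edge `{3, 5}`. -/
def chordedFanDiamond : Template 7 where
  rows := [30, 113, 105, 53, 11, 78, 38]
  carrier := 30
  ne := inter (square 0) (around (through (inter (nbr (point 2)) (nbr (point 3)))))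
  seps := separators

/-- The triangle `{0, 1, 2}`, a vertex for each of its three edges that is joined to both ends, and
a further vertex joined to these three. -/
def apexTriangle : Template 7 where
  rows := [30, 85, 75, 37, 35, 88, 38]
  carrier := 30
  ne := inter (square 0) (around (comp adj (comp (inter (square 1) (square 2)) adj)))
  seps := separators ++ [through (nbr (inter (nbr (point 0)) (nbr (point 1)))),
    through (nbr (inter (nbr (point 1)) (nbr (point 2))))]

/-- The Moser spindle. -/
def moserSpindle : Template 7 where
  rows := [30, 69, 67, 49, 41, 88, 38]
  carrier := 57
  ne := inter (around (square 5)) (around (through (nbr (point 0))))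
  seps := separators

/-- The complement of the graph that consists of two vertices joined by three disjoint paths, of
lengths two, three and three. -/
def thetaComplement : Template 7 where
  rows := [30, 85, 75, 53, 43, 88, 38]
  carrier := 85
  ne := inter (square 1) (around (comp adj (comp (inter (square 0) (square 2)) adj)))
  seps := separators

/-- The complement of the cycle of length seven. -/
def heptagonComplement : Template 7 where
  rows := [30, 113, 105, 85, 43, 86, 46]
  carrier := 30
  ne := comp (comp (inter adj (comp (inter adj (comp (inter adj (square 0)) adj)) adj)) adj)
    (inter adj (comp adj (inter adj (comp adj (inter adj (square 0))))))
  seps := separators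

/-! ### Searching through the graphs on few vertices -/

namespace Search

/-- The value `f x`. In the kernel, evaluating `force x f` first reduces `x` to a numeral. -/
def force {α : Type} (x : ℕ) (f : ℕ → α) : α :=
  Nat.rec (motive := fun _ => α) (f 0) (fun k _ => f (Nat.succ k)) x

theorem force_eq {α : Type} (x : ℕ) (f : ℕ → α) : force x f = f x := by
  cases x <;> rfl

/-- The encoding of the symmetric relation `{(u, v), (v, u)}`. -/
def pair (u v : ℕ) : ℕ := Nat.lor (2 ^ (8 * u + v)) (2 ^ (8 * v + u))

/-- The set of all `y` that are related to `x`, as a bit vector. -/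
def row (M x : ℕ) : ℕ := Nat.land (Nat.shiftRight M (Nat.mul 8 x)) 255

/-- Whether some row of `hi` is contained in a different row of `lo`. -/
def dominated (n lo hi : ℕ) : Bool :=
  (List.range n).any fun u => force (row hi u) fun r => (List.range n).any fun v =>
    Nat.beq (Nat.land r (row lo v)) r && !Nat.beq u v

/-- The number of ones among the first `n` binary digits of a number. -/
def size : ℕ → ℕ → ℕ
  | 0, _ => 0
  | n + 1, x => Nat.add (size n (Nat.div x 2)) (Nat.mod x 2)

/-- Whether some row of `lo` has more than `d` elements, or one of the rows `1, …, d` has more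
than `e` elements. -/
def exceeds (n d e lo : ℕ) : Bool :=
  (List.range n).any fun u =>
    Nat.blt (bif Nat.blt 0 u && Nat.ble u d then e else d) (size n (row lo u))

/-- Shrinks the sets of admissible values at `j, j + 1, …` to `near` or `far` according to the
digits of `s`, and passes them on; the result is `none` if one of them becomes empty. -/
def restrict {α : Type} (s near far : ℕ) : List ℕ → ℕ → (List ℕ → Option α) → Option α
  | [], _, k => k []
  | x :: ds, j, k => force (Nat.land x (bif Nat.testBit s j then near else far)) fun y =>
      bif Nat.beq y 0 then none else restrict s near far ds (j + 1) fun ds' => k (y :: ds')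

/-- Backtracking search for a map `φ` with prescribed sets of admissible values at `i, i + 1, …`.
The choice `φ i = c` restricts the value at `j` to `near c` if `j` belongs to `src i`, and to
`far c` otherwise. No property of the result is used without being checked. -/
def findMap (n : ℕ) (src near far : ℕ → ℕ) : ℕ → ℕ → List ℕ → Option (List ℕ)
  | 0, _, _ => some []
  | _ + 1, _, [] => some []
  | k + 1, i, d :: ds => (List.range n).findSome? fun c =>
      bif Nat.testBit d c then
        restrict (src i) (near c) (far c) ds (i + 1) fun ds' =>
          (findMap n src near far k (i + 1) ds').map (c :: ·)
      else none

/-- Whether `φ` maps all pairs in `hi` to pairs in `lo`, and is not injective. -/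
def isFold (n lo hi : ℕ) (φ : List ℕ) : Bool :=
  (List.range n).all (fun u => Nat.blt (φ.getD u 0) n && (List.range n).all fun v =>
    !bit hi u v || bit lo (φ.getD u 0) (φ.getD v 0)) &&
  (List.range n).any fun u => (List.range n).any fun v =>
    !Nat.beq u v && Nat.beq (φ.getD u 0) (φ.getD v 0)

/-- Whether `φ` is injective, maps all pairs in `hi` to pairs in `M`, and reflects the pairs in `M`
to pairs in `lo`. -/
def isIso (n lo hi M : ℕ) (φ : List ℕ) : Bool :=
  (List.range n).all fun u => Nat.blt (φ.getD u 0) n && (List.range n).all fun v =>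
    (Nat.beq u v || !Nat.beq (φ.getD u 0) (φ.getD v 0)) &&
    (!bit hi u v || bit M (φ.getD u 0) (φ.getD v 0)) &&
    (bit lo u v || !bit M (φ.getD u 0) (φ.getD v 0))

/-- Whether an isomorphism to the relation `M` is found; its values preserve the degree. -/
def hasIso (n lo hi M : ℕ) : Bool :=
  match findMap n (row lo) (row M) (fun c => 255 ^^^ (row M c ||| 2 ^ c)) n 0
    ((List.range n).map fun u =>
      bitsOf (fun v => Nat.beq (size n (row lo u)) (size n (row M v))) n) with
  | none => false
  | some φ => isIso n lo hi M φ

/-- Whether an endomorphism is found that misses a vertex `t`. Vertices of low degree are the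
likeliest to be missed, and are tried first. -/
def hasFold (n lo hi : ℕ) : Bool :=
  (List.range n).any fun d => (List.range n).any fun t => Nat.beq (size n (row lo t)) d &&
    match findMap n (row hi) (row lo) (fun _ => 255) n 0
      (List.replicate n ((2 ^ n - 1) ^^^ 2 ^ t)) with
    | none => false
    | some φ => isFold n lo hi φ

/-- Whether the graph is found to be isomorphic to a template, or not to be a core. Only templates
with the same number of edges are tried. -/
def leaf {n : ℕ} (ts : List (Template n)) (lo hi : ℕ) : Bool :=
  (force (size 64 lo) fun m => ts.any fun t =>
    Nat.beq (size 64 t.edges) m && hasIso n lo hi t.edges) || hasFold n lo hi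

/-- Decides in turn, for each pair in a list, whether it is an edge, and checks that all graphs
that contain `lo` and are contained in `hi` either are isomorphic to a template, or are not cores,
or violate the bounds on the degrees. Partial graphs are tested when a row is complete. -/
def search {n : ℕ} (ts : List (Template n)) (d e : ℕ) : List (ℕ × ℕ) → ℕ → ℕ → Bool
  | [], lo, hi => exceeds n d e lo || dominated n lo hi || leaf ts lo hi
  | (u, v) :: es, lo, hi =>
    (Nat.beq v (u + 1) && (exceeds n d e lo || dominated n lo hi)) ||
      ((force (Nat.lor lo (pair u v)) fun lo => search ts d e es lo hi) &&
       (force (Nat.xor hi (pair u v)) fun hi => search ts d e es lo hi))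

/-- The pairs `(u, v)` with `2 ≤ u < v < n`. -/
def pairs (n : ℕ) : List (ℕ × ℕ) :=
  (List.range n).flatMap fun u => ((List.range n).filter fun v => Nat.ble 2 u && Nat.blt u v).map
    fun v => (u, v)

/-- Whether `v` is prescribed as a neighbour of `u ∈ {0, 1}`: the neighbours of `0` are `1, …, d`,
and the neighbours of `1` other than `0` are `2, …, a + 1` and `d + 1, …, d + b`. -/
def firstRows (d a b u v : ℕ) : Bool :=
  (Nat.beq u 0 && Nat.ble 1 v && Nat.ble v d) ||
    (Nat.beq u 1 &&
      ((Nat.ble 2 v && Nat.ble v (a + 1)) || (Nat.ble (d + 1) v && Nat.ble v (d + b))))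

/-- The edges at `0` and `1`. -/
def start (d a b : ℕ) : ℕ := encode fun u v => firstRows d a b u v || firstRows d a b v u

/-- The pairs of distinct vertices other than `0` and `1`. -/
def free (n : ℕ) : ℕ := encode fun u v =>
  Nat.ble 2 u && Nat.ble 2 v && Nat.blt u n && Nat.blt v n && !Nat.beq u v

/-- The search through all graphs on `n` vertices in normal form whose maximal degree is less
than `D`. -/
def run {n : ℕ} (ts : List (Template n)) (D : ℕ) : Bool :=
  (List.range D).all fun d => (List.range d).all fun a => (List.range (n - d)).all fun b =>
    Nat.ble d (a + b) || force (start d a b) fun lo => force (Nat.lor lo (free n)) fun hi =>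
      search ts d (a + b + 1) (pairs n) lo hi

/-! ### Soundness of the search -/

theorem beq_eq_false_iff_ne {x y : ℕ} : Nat.beq x y = false ↔ x ≠ y := by
  rw [← Bool.not_eq_true, Nat.beq_eq]

theorem testBit_row (M x : ℕ) {y : ℕ} (hy : y < 8) : (row M x).testBit y = bit M x y := by
  change ((M >>> (8 * x)) &&& 255).testBit y = M.testBit (8 * x + y)
  rw [Nat.testBit_and, Nat.testBit_shiftRight, show 255 = 2 ^ 8 - 1 from rfl,
    Nat.testBit_two_pow_sub_one]
  simp [hy]

theorem bit_pair {u v x y : ℕ} (hu : u < 8) (hv : v < 8) (hy : y < 8) :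
    bit (pair u v) x y = true ↔ (x = u ∧ y = v) ∨ (x = v ∧ y = u) := by
  change (2 ^ (8 * u + v) ||| 2 ^ (8 * v + u)).testBit (8 * x + y) = true ↔ _
  simp only [Nat.testBit_or, Nat.testBit_two_pow, Bool.or_eq_true, decide_eq_true_eq]
  omega

theorem size_eq_card (n x : ℕ) :
    size n x = (Finset.univ.filter fun i : Fin n => x.testBit i = true).card := by
  induction n generalizing x with
  | zero => simp [size]
  | succ n ih =>
    have h : size (n + 1) x = size n (x / 2) + x % 2 := rfl
    rw [h, ih, Fin.card_filter_univ_succ]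
    simp only [Fin.val_zero, Fin.val_succ, Nat.testBit_succ, Nat.testBit_zero]
    rcases Nat.mod_two_eq_zero_or_one x with hx | hx <;> simp [hx]

variable {n : ℕ} {H : SimpleGraph (Fin n)} {lo hi : ℕ}

/-- All pairs in `lo` are edges of `H`, and all edges of `H` are pairs in `hi`. -/
def Between (H : SimpleGraph (Fin n)) (lo hi : ℕ) : Prop :=
  ∀ u v : Fin n, (bit lo u v = true → H.Adj u v) ∧ (H.Adj u v → bit hi u v = true)

theorem Between.dominated_eq_false (hn : n ≤ 8) (h : Between H lo hi) (hH : H.IsCore) :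
    dominated n lo hi = false := by
  rw [← Bool.not_eq_true]
  intro hdom
  simp only [dominated, force_eq, List.any_eq_true, List.mem_range, Bool.and_eq_true, Nat.beq_eq,
    Bool.not_eq_true', beq_eq_false_iff_ne] at hdom
  obtain ⟨u, hu, v, hv, hsub, huv⟩ := hdom
  obtain ⟨w, hw, hvw⟩ := hH.exists_adj_not_adj (u := ⟨u, hu⟩) (v := ⟨v, hv⟩) (by simpa using huv)
  have hw8 : (w : ℕ) < 8 := w.2.trans_le hn
  have h1 := (h _ _).2 hw
  change bit hi u w = true at h1
  rw [← testBit_row hi u hw8, ← hsub] at h1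
  change (row hi u &&& row lo v).testBit w = true at h1
  rw [Nat.testBit_and, testBit_row lo v hw8, Bool.and_eq_true] at h1
  exact hvw ((h ⟨v, hv⟩ w).1 h1.2)

theorem Between.exceeds_eq_false (hn : n ≤ 8) [DecidableRel H.Adj] (h : Between H lo hi)
    {d e : ℕ} (hd : ∀ u, H.degree u ≤ d)
    (he : ∀ u : Fin n, 0 < (u : ℕ) → (u : ℕ) ≤ d → H.degree u ≤ e) : exceeds n d e lo = false := by
  rw [← Bool.not_eq_true]
  intro hex
  simp only [exceeds, List.any_eq_true, List.mem_range] at hex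
  obtain ⟨u, hu, hex⟩ := hex
  have hle : size n (row lo u) ≤ H.degree ⟨u, hu⟩ := by
    rw [size_eq_card, ← card_neighborFinset_eq_degree]
    refine Finset.card_le_card fun w hw => ?_
    rw [Finset.mem_filter, testBit_row lo u (w.2.trans_le hn)] at hw
    rw [mem_neighborFinset]
    exact (h ⟨u, hu⟩ w).1 hw.2
  have h1 := hd ⟨u, hu⟩
  have h2 := he ⟨u, hu⟩
  simp only [Nat.blt_eq] at hex
  by_cases hc : 0 < u ∧ u ≤ d
  · have := h2 hc.1 hc.2
    have hb : (Nat.blt 0 u && Nat.ble u d) = true := by simpa [Nat.blt_eq] using hc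
    rw [hb, cond_true] at hex
    omega
  · have hb : (Nat.blt 0 u && Nat.ble u d) = false := by
      rw [← Bool.not_eq_true]; simpa [Nat.blt_eq] using hc
    rw [hb, cond_false] at hex
    omega

theorem Between.isFold_eq_false (h : Between H lo hi) (hH : H.IsCore) (φ : List ℕ) :
    isFold n lo hi φ = false := by
  rw [← Bool.not_eq_true]
  intro hf
  simp only [isFold, Bool.and_eq_true, List.all_eq_true, List.any_eq_true, List.mem_range,
    Nat.blt_eq, Bool.or_eq_true, Bool.not_eq_true', Nat.beq_eq, beq_eq_false_iff_ne] at hf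
  obtain ⟨h1, u, hu, v, hv, huv, heq⟩ := hf
  let ψ : H →g H := ⟨fun x => ⟨φ.getD x 0, (h1 x x.2).1⟩, fun {x y} hxy => by
    refine (h _ _).1 (((h1 x x.2).2 y y.2).resolve_left fun hb => ?_)
    rw [(h x y).2 hxy] at hb
    exact Bool.noConfusion hb⟩
  have hinj := Finite.injective_iff_surjective.2 (isCore_iff_forall_surjective.1 hH ψ)
  have := @hinj ⟨u, hu⟩ ⟨v, hv⟩ (Fin.ext heq)
  exact huv (congrArg Fin.val this)

theorem Between.nonempty_iso (h : Between H lo hi) {t : Template n} (ht : t.Valid) {φ : List ℕ}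
    (hf : isIso n lo hi t.edges φ = true) : Nonempty (H ≃g t.graph) := by
  simp only [isIso, Bool.and_eq_true, List.all_eq_true, List.mem_range,
    Nat.blt_eq, Bool.or_eq_true, Bool.not_eq_true', Nat.beq_eq, beq_eq_false_iff_ne] at hf
  let ψ : Fin n → Fin n := fun x => ⟨φ.getD x 0, (hf x x.2).1⟩
  have hinj : Function.Injective ψ := by
    intro x y hxy
    have := ((hf x x.2).2 y y.2).1.1
    exact Fin.ext (this.resolve_right fun hne => hne (congrArg Fin.val hxy))
  refine ⟨⟨Equiv.ofBijective ψ (Finite.injective_iff_bijective.1 hinj), fun {x y} => ?_⟩⟩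
  change t.graph.Adj (ψ x) (ψ y) ↔ H.Adj x y
  rw [← ht.1]
  obtain ⟨⟨-, h1⟩, h2⟩ := (hf x x.2).2 y y.2
  constructor
  · intro hxy
    refine (h x y).1 (h2.resolve_right fun hb => ?_)
    exact Bool.noConfusion (hb.symm.trans hxy)
  · intro hxy
    refine h1.resolve_left fun hb => ?_
    exact Bool.noConfusion (hb.symm.trans ((h x y).2 hxy))

theorem Between.exists_iso_of_leaf (h : Between H lo hi) (hH : H.IsCore) {ts : List (Template n)}
    (hts : ∀ t ∈ ts, t.Valid) (hl : leaf ts lo hi = true) :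
    ∃ t ∈ ts, Nonempty (H ≃g t.graph) := by
  simp only [leaf, force_eq, Bool.or_eq_true, List.any_eq_true, Bool.and_eq_true] at hl
  rcases hl with ⟨t, ht, -, hl⟩ | hl
  · refine ⟨t, ht, ?_⟩
    unfold hasIso at hl
    split at hl
    · exact absurd hl Bool.false_ne_true
    · exact h.nonempty_iso (hts t ht) hl
  · simp only [hasFold, List.any_eq_true, Bool.and_eq_true] at hl
    obtain ⟨d, -, t, -, -, hl⟩ := hl
    split at hl
    · exact absurd hl Bool.false_ne_true
    · rw [h.isFold_eq_false hH] at hl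
      exact absurd hl Bool.false_ne_true

theorem Between.exists_iso_of_search (hn : n ≤ 8) [DecidableRel H.Adj] (hH : H.IsCore) {d e : ℕ}
    (hd : ∀ u, H.degree u ≤ d)
    (he : ∀ u : Fin n, 0 < (u : ℕ) → (u : ℕ) ≤ d → H.degree u ≤ e) {ts : List (Template n)}
    (hts : ∀ t ∈ ts, t.Valid) {es : List (ℕ × ℕ)} (hes : ∀ p ∈ es, p.1 < n ∧ p.2 < n)
    (h : Between H lo hi) (hs : search ts d e es lo hi = true) :
    ∃ t ∈ ts, Nonempty (H ≃g t.graph) := by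
  have hlt : ∀ z : Fin n, (z : ℕ) < 8 := fun z => z.2.trans_le hn
  induction es generalizing lo hi with
  | nil =>
    rw [search, h.exceeds_eq_false hn hd he, h.dominated_eq_false hn hH] at hs
    exact h.exists_iso_of_leaf hH hts hs
  | cons p es ih =>
    obtain ⟨u, v⟩ := p
    rw [search, h.exceeds_eq_false hn hd he, h.dominated_eq_false hn hH, force_eq, force_eq] at hs
    simp only [Bool.or_false, Bool.and_false, Bool.false_or, Bool.and_eq_true] at hs
    obtain ⟨hu, hv⟩ : u < n ∧ v < n := hes (u, v) (by simp)
    replace ih := fun {lo hi : ℕ} => @ih lo hi fun p hp => hes p (List.mem_cons_of_mem _ hp)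
    have hp := fun x y : Fin n => bit_pair (hu.trans_le hn) (hv.trans_le hn) (hlt y) (x := x)
    by_cases huv : H.Adj ⟨u, hu⟩ ⟨v, hv⟩
    · refine ih (fun x y => ⟨fun hb => ?_, (h x y).2⟩) hs.1
      change (lo ||| pair u v).testBit (8 * x + y) = true at hb
      rw [Nat.testBit_or, Bool.or_eq_true] at hb
      rcases hb with hb | hb
      · exact (h x y).1 hb
      · rcases (hp x y).1 hb with ⟨hx, hy⟩ | ⟨hx, hy⟩
        · rwa [show x = ⟨u, hu⟩ from Fin.ext hx, show y = ⟨v, hv⟩ from Fin.ext hy]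
        · rw [show x = ⟨v, hv⟩ from Fin.ext hx, show y = ⟨u, hu⟩ from Fin.ext hy]
          exact huv.symm
    · refine ih (fun x y => ⟨(h x y).1, fun hxy => ?_⟩) hs.2
      change (hi ^^^ pair u v).testBit (8 * x + y) = true
      rw [Nat.testBit_xor]
      have h1 : hi.testBit (8 * x + y) = true := (h x y).2 hxy
      have h2 : (pair u v).testBit (8 * x + y) = false := by
        rw [← Bool.not_eq_true]
        intro hb
        rcases (hp x y).1 hb with ⟨hx, hy⟩ | ⟨hx, hy⟩
        · rw [show x = ⟨u, hu⟩ from Fin.ext hx, show y = ⟨v, hv⟩ from Fin.ext hy] at hxy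
          exact huv hxy
        · rw [show x = ⟨v, hv⟩ from Fin.ext hx, show y = ⟨u, hu⟩ from Fin.ext hy] at hxy
          exact huv hxy.symm
      rw [h1, h2]; rfl

/-- A graph is in normal form if `0` has the neighbours `1, …, d` and `1` has, apart from `0`, the
neighbours `2, …, a + 1` and `d + 1, …, d + b`, where `d` is the maximal degree, and the degree
of `1` is maximal among the neighbours of `0`. -/
structure IsNormal (H : SimpleGraph (Fin n)) [DecidableRel H.Adj] (d a b : ℕ) : Prop where
  adj_zero : ∀ u v : Fin n, (u : ℕ) = 0 → (H.Adj u v ↔ 1 ≤ (v : ℕ) ∧ (v : ℕ) ≤ d)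
  adj_one : ∀ u v : Fin n, (u : ℕ) = 1 → (H.Adj u v ↔ (v : ℕ) = 0 ∨
    (2 ≤ (v : ℕ) ∧ (v : ℕ) ≤ a + 1) ∨ (d + 1 ≤ (v : ℕ) ∧ (v : ℕ) ≤ d + b))
  lt_of_add : a + b < d
  lt_card : d + b < n
  degree_le : ∀ u, H.degree u ≤ d
  degree_le_of_adj : ∀ u : Fin n, 0 < (u : ℕ) → (u : ℕ) ≤ d → H.degree u ≤ a + b + 1

theorem IsNormal.between [DecidableRel H.Adj] (hn : n ≤ 8) {d a b : ℕ} (h : IsNormal H d a b) :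
    Between H (start d a b) (Nat.lor (start d a b) (free n)) := by
  have hlt : ∀ z : Fin n, (z : ℕ) < 8 := fun z => z.2.trans_le hn
  have hF : ∀ u v : Fin n, firstRows d a b u v = true → H.Adj u v := by
    intro u v huv
    simp only [firstRows, Bool.or_eq_true, Bool.and_eq_true, Nat.beq_eq, Nat.ble_eq] at huv
    rcases huv with ⟨⟨hu, h1⟩, h2⟩ | ⟨hu, huv⟩
    · exact (h.adj_zero u v hu).2 ⟨h1, h2⟩
    · exact (h.adj_one u v hu).2 (Or.inr huv)
  have hF' : ∀ u v : Fin n, H.Adj u v → (u : ℕ) < 2 →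
      (firstRows d a b u v || firstRows d a b v u) = true := by
    intro u v huv hu
    have hd := h.lt_of_add
    simp only [firstRows, Bool.or_eq_true, Bool.and_eq_true, Nat.beq_eq, Nat.ble_eq]
    interval_cases hu' : (u : ℕ)
    · have := (h.adj_zero u v hu').1 huv
      omega
    · have := (h.adj_one u v hu').1 huv
      omega
  intro u v
  constructor
  · intro hb
    rw [start, bit_encode _ (hlt u) (hlt v), Bool.or_eq_true] at hb
    rcases hb with hb | hb
    · exact hF u v hb
    · exact (hF v u hb).symm
  · intro huv
    change (start d a b ||| free n).testBit (8 * u + v) = true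
    rw [Nat.testBit_or]
    change (bit (start d a b) u v || bit (free n) u v) = true
    rw [start, free, bit_encode _ (hlt u) (hlt v), bit_encode _ (hlt u) (hlt v)]
    by_cases hu : (u : ℕ) < 2
    · rw [hF' u v huv hu]; rfl
    by_cases hv : (v : ℕ) < 2
    · rw [Bool.or_comm (firstRows d a b u v), hF' v u huv.symm hv]; rfl
    · have huv' : (u : ℕ) ≠ v := fun h => huv.ne (Fin.ext h)
      simp only [Bool.or_eq_true, Bool.and_eq_true, Nat.ble_eq, Nat.blt_eq, Bool.not_eq_true',
        beq_eq_false_iff_ne]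
      omega

theorem IsNormal.exists_iso [DecidableRel H.Adj] (hn : n ≤ 8) {d a b D : ℕ} (h : IsNormal H d a b)
    (hD : d < D) (hH : H.IsCore) {ts : List (Template n)} (hts : ∀ t ∈ ts, t.Valid)
    (hrun : run ts D = true) : ∃ t ∈ ts, Nonempty (H ≃g t.graph) := by
  have h1 := h.lt_of_add
  have h2 := h.lt_card
  simp only [run, List.all_eq_true, List.mem_range, force_eq] at hrun
  have hs := hrun d hD a (by omega) b (by omega)
  rw [Bool.or_eq_true, Nat.ble_eq] at hs
  refine (h.between hn).exists_iso_of_search hn hH h.degree_le h.degree_le_of_adj hts ?_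
    (hs.resolve_left (by omega))
  intro p hp
  simp only [pairs, List.mem_flatMap, List.mem_map, List.mem_filter, List.mem_range] at hp
  obtain ⟨u, hu, v, ⟨hv, -⟩, rfl⟩ := hp
  exact ⟨hu, hv⟩

end Search

/-! ### The normal form -/

namespace Search

/-- In a sorted sequence of numbers, the first elements are those with the smallest values. -/
theorem le_iff_lt_card_of_monotone {n : ℕ} {g : Fin n → ℕ} (hg : Monotone g) (k : ℕ) (i : Fin n) :
    g i ≤ k ↔ (i : ℕ) < (Finset.univ.filter fun j => g j ≤ k).card := by
  constructor
  · intro h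
    have : Finset.Iic i ⊆ Finset.univ.filter fun j => g j ≤ k := fun j hj =>
      Finset.mem_filter.2 ⟨Finset.mem_univ _, (hg (Finset.mem_Iic.1 hj)).trans h⟩
    have := Finset.card_le_card this
    rw [Fin.card_Iic] at this
    omega
  · intro h
    by_contra hk
    have : (Finset.univ.filter fun j => g j ≤ k) ⊆ Finset.Iio i := fun j hj => by
      rw [Finset.mem_Iio]
      by_contra hij
      exact hk ((hg (not_lt.1 hij)).trans (Finset.mem_filter.1 hj).2)
    have := Finset.card_le_card this
    rw [Fin.card_Iio] at this
    omega

open Classical in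
/-- A graph with a nonisolated vertex is isomorphic to one in normal form: sort the vertices
by their adjacency to a vertex of maximal degree and to a neighbour of it of maximal degree. -/
theorem exists_isNormal {V : Type*} [Fintype V] {H : SimpleGraph V} {n : ℕ}
    (hV : Fintype.card V = n) (hne : ∃ u v, H.Adj u v) :
    ∃ H' : SimpleGraph (Fin n), Nonempty (H' ≃g H) ∧ ∃ d a b, IsNormal H' d a b ∧
      ∃ u, H'.degree u = d := by
  obtain ⟨x, y, hxy⟩ := hne
  have : Nonempty V := ⟨x⟩
  obtain ⟨v₀, hv₀⟩ := H.exists_maximal_degree_vertex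
  have hdeg : ∀ v, H.degree v ≤ H.degree v₀ := fun v => hv₀ ▸ H.degree_le_maxDegree v
  have hnbr : (H.neighborFinset v₀).Nonempty := by
    rw [← Finset.card_pos, card_neighborFinset_eq_degree]
    exact ((H.degree_pos_iff_exists_adj x).2 ⟨y, hxy⟩).trans_le (hdeg x)
  obtain ⟨v₁, hv₁, hmax⟩ := Finset.exists_max_image _ (fun v => H.degree v) hnbr
  rw [mem_neighborFinset] at hv₁
  have h01 : v₀ ≠ v₁ := hv₁.ne
  set N₀ := H.neighborFinset v₀ with hN₀
  set N₁ := H.neighborFinset v₁ with hN₁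
  have hm₀ : ∀ v, v ∈ N₀ ↔ H.Adj v₀ v := fun v => by simp [hN₀]
  have hm₁ : ∀ v, v ∈ N₁ ↔ H.Adj v₁ v := fun v => by simp [hN₁]
  have hc₀ : N₀.card = H.degree v₀ := card_neighborFinset_eq_degree _ _
  have hc₁ : N₁.card = H.degree v₁ := card_neighborFinset_eq_degree _ _
  have h0 : v₀ ∉ N₀ := by simp [hm₀]
  have h1 : v₁ ∉ N₁ := by simp [hm₁]
  have h01' : v₀ ∈ N₁ := by simp [hm₁, hv₁.symm]
  have h10 : v₁ ∈ N₀ := by simp [hm₀, hv₁]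
  set d := H.degree v₀ with hd
  set a := (N₀ ∩ N₁).card with ha
  obtain ⟨b, hb⟩ : ∃ b, (N₁ \ N₀).card = b + 1 :=
    Nat.exists_eq_add_one.2 (Finset.card_pos.2 ⟨v₀, by simp [h01', h0]⟩)
  have hab : H.degree v₁ = a + b + 1 := by
    rw [← hc₁, ← Finset.card_inter_add_card_sdiff N₁ N₀, hb, ha, Finset.inter_comm]; omega
  -- The vertices are sorted by `c`, so that each set of the form `{v | c v ≤ k}` becomes an initial
  -- segment of `Fin n`.
  let c : V → ℕ := fun v => if v = v₀ then 0 else if v = v₁ then 1 else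
    if v ∈ N₀ then (if v ∈ N₁ then 2 else 3) else if v ∈ N₁ then 4 else 5
  let e : Fin n ≃ V := (Fintype.equivFinOfCardEq hV).symm
  let σ : Fin n ≃ V := (Tuple.sort (c ∘ e)).trans e
  have hσ : Monotone (c ∘ σ) := Tuple.monotone_sort (c ∘ e)
  have key : ∀ (k : ℕ) (s : Finset V), (∀ v, c v ≤ k ↔ v ∈ s) →
      ∀ i, σ i ∈ s ↔ (i : ℕ) < s.card := by
    intro k s hs i
    rw [← hs, show c (σ i) ≤ k ↔ _ from le_iff_lt_card_of_monotone hσ k i]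
    have : (Finset.univ.filter fun j => (c ∘ σ) j ≤ k).map σ.toEmbedding = s := by
      ext v
      simp only [Finset.mem_map_equiv, Finset.mem_filter, Finset.mem_univ, true_and,
        Function.comp_apply, Equiv.apply_symm_apply, hs]
    rw [← this, Finset.card_map]
  have k0 := key 0 {v₀} (fun v => by simp only [c]; grind)
  have k1 := key 1 {v₀, v₁} (fun v => by simp only [c]; grind)
  have k2 := key 2 (insert v₀ (insert v₁ (N₀ ∩ N₁))) (fun v => by simp only [c]; grind)
  have k3 := key 3 (insert v₀ N₀) (fun v => by simp only [c]; grind)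
  have k4 := key 4 (N₀ ∪ N₁) (fun v => by simp only [c]; grind)
  have e2 : (insert v₀ (insert v₁ (N₀ ∩ N₁))).card = a + 2 := by
    rw [Finset.card_insert_of_notMem (by simp [h01, h0]),
      Finset.card_insert_of_notMem (by simp [h1])]
  have e3 : (insert v₀ N₀).card = d + 1 := by rw [Finset.card_insert_of_notMem h0, hc₀]
  have e4 : (N₀ ∪ N₁).card = d + b + 1 := by
    rw [← Finset.union_sdiff_self_eq_union, Finset.card_union_of_disjoint Finset.disjoint_sdiff, hb,
      hc₀, add_assoc]
  rw [Finset.card_singleton] at k0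
  rw [Finset.card_pair h01] at k1
  rw [e2] at k2
  rw [e3] at k3
  rw [e4] at k4
  obtain ⟨H', hH'⟩ : ∃ H', H' = H.comap σ := ⟨_, rfl⟩
  have hadj : ∀ i j, H'.Adj i j ↔ H.Adj (σ i) (σ j) := fun i j => by rw [hH']; exact Iff.rfl
  let iso : H' ≃g H := ⟨σ, fun {i j} => (hadj i j).symm⟩
  have hdeg' : ∀ i, H'.degree i = H.degree (σ i) := fun i => (iso.degree_eq i).symm
  refine ⟨H', ⟨iso⟩, d, a, b, ⟨?_, ?_, ?_, ?_, ?_, ?_⟩, σ.symm v₀,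
    by rw [hdeg', Equiv.apply_symm_apply]⟩
  · intro i j hi
    have hi' : σ i = v₀ := by simpa using (k0 i).2 (by omega)
    have := k0 j
    have := k3 j
    rw [hadj, hi', ← hm₀]
    grind
  · intro i j hi
    have hi' : σ i = v₁ := by
      have := (k1 i).2 (by omega)
      have := k0 i
      grind
    have := k0 j
    have := k1 j
    have := k2 j
    have := k3 j
    have := k4 j
    rw [hadj, hi', ← hm₁]
    grind
  · have := hdeg v₁
    omega
  · have := Finset.card_le_univ (N₀ ∪ N₁)
    omega
  · intro i
    rw [hdeg']
    exact hdeg _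
  · intro i hi hid
    rw [hdeg', ← hab]
    apply hmax
    have := k0 i
    have := k3 i
    grind

end Search

/-! ### Projectivity of small cores -/

namespace Search

/-- The templates on `n` vertices. -/
def templates : (n : ℕ) → List (Template n)
  | 3 => [triangle]
  | 5 => [pentagon]
  | 7 => [heptagon, fanDiamond, closedStrip, chordedFanDiamond, apexTriangle, moserSpindle,
      thetaComplement, heptagonComplement]
  | _ => []

theorem valid_of_mem_templates_three : ∀ t ∈ templates 3, t.Valid := by decide +kernel

theorem valid_of_mem_templates_five : ∀ t ∈ templates 5, t.Valid := by decide +kernel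

theorem valid_of_mem_templates_seven : ∀ t ∈ templates 7, t.Valid := by decide +kernel

theorem run_three : run (templates 3) 3 = true := by decide +kernel

theorem run_four : run (templates 4) 3 = true := by decide +kernel

theorem run_five : run (templates 5) 4 = true := by decide +kernel

theorem run_six : run (templates 6) 5 = true := by decide +kernel

theorem run_seven : run (templates 7) 6 = true := by decide +kernel

end Search

open Search in
/-- The cores that the search covers: all those on three vertices, and those on at most seven
vertices that have no universal vertex. -/
theorem IsCore.isProjective_of_search {V : Type*} [Fintype V] {H : SimpleGraph V} (hH : H.IsCore)
    {n : ℕ} (hV : Fintype.card V = n) (h3 : 3 ≤ n) (h7 : n ≤ 7)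
    (hu : n = 3 ∨ ∀ u, ∃ v, v ≠ u ∧ ¬ H.Adj u v) : H.IsProjective := by
  classical
  have hne : ∃ u v, H.Adj u v := by
    have : Nontrivial V := Fintype.one_lt_card_iff_nontrivial.1 (by omega)
    obtain ⟨u, v, huv⟩ := exists_pair_ne V
    obtain ⟨w, hw, -⟩ := hH.exists_adj_not_adj huv
    exact ⟨u, w, hw⟩
  obtain ⟨H', ⟨e⟩, d, a, b, hN, u, hud⟩ := exists_isNormal hV hne
  have hd : d < n := by simpa [hud] using H'.degree_lt_card_verts u
  have hd' : n = 3 ∨ d + 1 < n := by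
    refine hu.imp_right fun hu => ?_
    obtain ⟨v, hvu, hv⟩ := hu (e u)
    have hsub : H'.neighborFinset u ⊆ Finset.univ \ {u, e.symm v} := by
      intro w hw
      rw [mem_neighborFinset] at hw
      have h1 : w ≠ u := hw.ne'
      have h2 : w ≠ e.symm v := by
        rintro rfl
        exact hv (by simpa using e.map_adj_iff.2 hw)
      simp [h1, h2]
    have hle := Finset.card_le_card hsub
    have huv : u ≠ e.symm v := fun h => hvu (by rw [h]; simp)
    rw [card_neighborFinset_eq_degree, hud, Finset.card_sdiff_of_subset (Finset.subset_univ _),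
      Finset.card_pair huv, Finset.card_univ, Fintype.card_fin] at hle
    omega
  have hcore : H'.IsCore := hH.of_iso e.symm
  suffices h : ∃ t : Template n, t.Valid ∧ Nonempty (H' ≃g t.graph) by
    obtain ⟨t, ht, ⟨e'⟩⟩ := h
    exact (ht.isProjective (by omega) (by omega)).of_iso (e.symm.trans e')
  have key : ∀ D, d < D → run (templates n) D = true → (∀ t ∈ templates n, t.Valid) →
      ∃ t : Template n, t.Valid ∧ Nonempty (H' ≃g t.graph) := by
    intro D hD hrun hts
    obtain ⟨t, ht, h⟩ := hN.exists_iso (by omega) hD hcore hts hrun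
    exact ⟨t, hts t ht, h⟩
  interval_cases n
  · exact key _ hd run_three valid_of_mem_templates_three
  · exact key _ (by omega) run_four (by simp [templates])
  · exact key _ (by omega) run_five valid_of_mem_templates_five
  · exact key _ (by omega) run_six (by simp [templates])
  · exact key _ (by omega) run_seven valid_of_mem_templates_seven

/-- Universal vertices are removed one by one. -/
theorem IsCore.isProjective {n : ℕ} (h3 : 3 ≤ n) (h7 : n ≤ 7) {V : Type*} [Fintype V]
    {H : SimpleGraph V} (hH : H.IsCore) (hV : Fintype.card V = n) : H.IsProjective := by
  classical
  induction n, h3 using Nat.le_induction generalizing V with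
  | base => exact hH.isProjective_of_search hV le_rfl h7 (Or.inl rfl)
  | succ n hn ih =>
    by_cases hu : ∃ u, ∀ v, v ≠ u → H.Adj u v
    · obtain ⟨u, hu⟩ := hu
      have hcard : Fintype.card ({u}ᶜ : Set V) = n := by
        rw [Fintype.card_compl_set, hV]; simp
      have hcore := hH.induce_compl_singleton hu
      exact isProjective_of_induce_compl_singleton hu
        (Fintype.one_lt_card_iff_nontrivial.1 (by omega)) hcore
        (ih (by omega) hcore hcard)
    · push Not at hu
      exact hH.isProjective_of_search hV (by omega) h7 (Or.inr hu)

/-- On a cross product, `((a, b), (c, d)) ↦ (a, d)` is an idempotent polymorphism. -/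
theorem IsProjective.isIndecomposable {V : Type*} {H : SimpleGraph V} (h : H.IsProjective) :
    H.IsIndecomposable := by
  rintro ⟨A, B, G₁, G₂, hA, hB, ⟨e⟩⟩
  obtain ⟨i, hi⟩ := h.of_iso e.symm 2 one_le_two (fun x => ((x 0).1, (x 1).2))
    (fun x y hxy => ⟨(hxy 0).1, (hxy 1).2⟩) (fun _ => rfl)
  obtain ⟨a, a', ha⟩ := hA
  obtain ⟨b, b', hb⟩ := hB
  have hi := hi ![(a, b), (a', b')]
  fin_cases i
  · exact hb (congrArg Prod.snd hi).symm
  · exact ha (congrArg Prod.fst hi)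

end SimpleGraph

theorem mainTheorem1 {V : Type*} [Finite V] (H : SimpleGraph V) (hcore : H.IsCore)
    (h3 : 3 ≤ Nat.card V) (h7 : Nat.card V ≤ 7) :
    H.IsProjective ∧ (H.Connected → (H.IsProjective ↔ H.IsIndecomposable)) := by
  have := Fintype.ofFinite V
  have hp : H.IsProjective := hcore.isProjective h3 h7 Nat.card_eq_fintype_card.symm
  exact ⟨hp, fun _ => ⟨fun h => h.isIndecomposable, fun _ => hp⟩⟩
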